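/- **Setting.** Consider the process $\mathbf x_{k+1}=f_{a_k}(\mathbf x_k,\mathbf w_k)$ with states in $\mathbb R^n$, actions $a_k$ in a finite set $A$, and i.i.d. noise $\mathbf w_k$ with law $P_w$ on a bounded set $W\subset\mathbb R^d$; each $f_a:\mathbb R^n\times W\to\mathbb R^n$ is Borel measurable and Lipschitz in $w$ with a constant $L_w(x,a)$. Write $T^a(B\mid x)=P_w\{v\in W: f_a(x,v)\in B\}$. A strategy maps each finite state-action sequence to an action; $P_{x_0}^{\sigma_x}$ denotes the law of the process started at $x_0$ under the strategy $\sigma_x$. Let $X\subset\mathbb R^n$ be bounded, and let $r_i\subseteq X$ be finitely many regions with atomic propositions $\mathfrak p_i$ (true on $r_i$); let $\mathfrak p_u$ be true exactly on $\mathbb R^n\setminus X$. Let $L(x)$ be the set of propositions true at $x$. Let $Q=Q_{\rm safe}\cup\{q_u\}$ be a finite set of Borel cells, where $Q_{\rm safe}$ is a partition of $X$ into non-empty cells, each of which is either contained in or disjoint from each $r_i$, and $q_u=\mathbb R^n\setminus X$. Let $J(x)$ be the cell containing $x$. LTL$_f$ formulas are built from $\top$, propositions, $\neg,\wedge$, next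 and until, with the standard semantics on finite non-empty traces; $\mathcal G$ is "globally". An infinite path satisfies a formula if some finite prefix of its trace of labels does. A robust MDP (RMDP) $\mathcal M$ on $Q$ with actions $A$ has sets $\Gamma_{q,a}\subseteq\mathcal P(Q)$ and labels $L(q)=L(x)$ for $x\in q$, and $q_u$ is absorbing: $\Gamma_{q_u,a}=\{\delta_{q_u}\}$. An adversary $\xi$ assigns to each finite path $\omega$ of cells and actions and each action $a$ an element of $\Gamma_{\mathrm{last}(\omega),a}$; with a strategy $\sigma$ and an initial state $q$ it determines a law $Pr_\xi^{q,\sigma}$ on paths. For a formula $\chi$ put $$\underline p_\chi^\sigma(q)=\inf_\xi Pr_\xi^{q,\sigma}[\omega\models\chi],\qquad \overline p_\chi^\sigma(q)=\sup_\xi Pr_\xi^{q,\sigma}[\omega\models\chi].$$ The strategy $\sigma^*$ is an optimal robust strategy for $\chi$ if $\underline p_\chi^{\sigma^*}(q)\ge\underline p_\chi^{\sigma}(q)$ for all $q\in Q$ and all strategies $\sigma$. **Theorem (Correctness).** Let $\beta\in(0,1)$ and let $\mathcal M$ be such an RMDP constructed from $N$ i.i.d. samples of $P_w$. Suppose that it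 is sound with confidence $1-\beta$: with probability at least $1-\beta$ over the samples, for all $q\in Q_{\rm safe}$, $x\in q$, $a\in A$, the distribution $q'\mapsto T^a(q'\mid x)$ belongs to $\Gamma_{q,a}$. Let $\varphi$ be an LTL$_f$ formula. 1. If $\sigma^*$ (which may depend on the samples) is an optimal robust strategy of $\mathcal M$ for $\varphi\wedge\mathcal G\neg\mathfrak p_u$, and $\sigma_x(\omega_x)=\sigma^*(J(\omega_x))$ is its refinement, where $J$ acts on the states of a trajectory, then with probability at least $1-\beta$ over the samples $$P_{x_0}^{\sigma_x}[\omega_x\models\varphi\wedge\mathcal G\neg\mathfrak p_u]\in[\underline p(q),\overline p(q)]\qquad\text{for all } q\in Q,\ x_0\in q,$$ where $\underline p=\underline p_\chi^{\sigma^*}$, $\overline p=\overline p_\chi^{\sigma^*}$ with $\chi=\varphi\wedge\mathcal G\neg\mathfrak p_u$. 2. Suppose that leaving $X$ cannot help to satisfy $\varphi$ in $\mathcal M$, i.e. every infinite sequence of cells that stays in $q_u$ once it is there and satisfies $\varphi$ also satisfies $\varphi\wedge\mathcal G\neg\mathfrak p_u$. If $\sigma^*$ is an optimal robust strategy of $\mathcal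 M$ for $\varphi$, then the same conclusion holds with $\chi=\varphi$. -/

import Mathlib

open MeasureTheory ProbabilityTheory
open scoped ENNReal NNReal

noncomputable section

namespace DataDrivenSynthesis

/-! ### Finite paths and strategies -/

/-- Finite state-action sequences `s₀ -a₀→ s₁ -a₁→ ⋯ -a_{K-1}→ s_K`. -/
inductive FinPath (S A : Type*) : Type _
  | init (s : S) : FinPath S A
  | step (ω : FinPath S A) (a : A) (s : S) : FinPath S A

namespace FinPath

variable {S S' A : Type*}

/-- The last state of a finite path. -/
def last : FinPath S A → S
  | init s => s
  | step _ _ s => s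

/-- Apply a map to every state of a finite path, keeping the actions. -/
def map (J : S → S') : FinPath S A → FinPath S' A
  | init s => init (J s)
  | step ω a s => step (ω.map J) a (J s)

/-- The finite path that consists of the first `k + 1` states of `s` and of the actions which the
strategy `σ` chooses along them. -/
def play (σ : FinPath S A → A) (s : ℕ → S) : ℕ → FinPath S A
  | 0 => init (s 0)
  | k + 1 => step (play σ s k) (σ (play σ s k)) (s (k + 1))

end FinPath

/-- A (deterministic, history-dependent) strategy. -/
abbrev Strategy (S A : Type*) := FinPath S A → A

/-! ### Linear temporal logic over finite traces -/

/-- Formulas `⊤ | p | ¬φ | φ₁ ∧ φ₂ | X φ | φ₁ U φ₂`. -/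
inductive LTLf (AP : Type*) : Type _
  | top : LTLf AP
  | atom (p : AP) : LTLf AP
  | neg (φ : LTLf AP) : LTLf AP
  | and (φ ψ : LTLf AP) : LTLf AP
  | next (φ : LTLf AP) : LTLf AP
  | untl (φ ψ : LTLf AP) : LTLf AP

namespace LTLf

variable {AP S : Type*}

/-- `F φ := ⊤ U φ`. -/
def eventually (φ : LTLf AP) : LTLf AP := untl top φ

/-- `G φ := ¬ F ¬ φ`. -/
def globally (φ : LTLf AP) : LTLf AP := neg (eventually (neg φ))

/-- `φ.Holds ρ K i`: the finite trace `ρ₀ ρ₁ ⋯ ρ_K` satisfies `φ` at position `i ≤ K`.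
The values of `ρ` beyond `K` play no role. -/
def Holds : LTLf AP → (ℕ → Set AP) → ℕ → ℕ → Prop
  | top, _, _, _ => True
  | atom p, ρ, _, i => p ∈ ρ i
  | neg φ, ρ, K, i => ¬ φ.Holds ρ K i
  | and φ ψ, ρ, K, i => φ.Holds ρ K i ∧ ψ.Holds ρ K i
  | next φ, ρ, K, i => i < K ∧ φ.Holds ρ K (i + 1)
  | untl φ ψ, ρ, K, i =>
      ∃ j, i ≤ j ∧ j ≤ K ∧ ψ.Holds ρ K j ∧ ∀ k, i ≤ k → k < j → φ.Holds ρ K k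

/-- The formula `φ ∧ G ¬p_u`, where `none` stands for the proposition `p_u`. -/
def andSafe {ι : Type*} (φ : LTLf (Option ι)) : LTLf (Option ι) :=
  and φ (globally (neg (atom none)))

/-- An infinite state sequence satisfies `φ` if some finite (nonempty) prefix of its trace does. -/
def SatBy (L : S → Set AP) (φ : LTLf AP) (s : ℕ → S) : Prop :=
  ∃ K, φ.Holds (fun k => L (s k)) K 0

end LTLf

/-! ### Robust Markov decision processes -/

/-- A labelled robust MDP with states `Q`, actions `A` (all available in every state) and atomic
propositions `AP`. No initial state is fixed: path probabilities take it as an argument. -/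
structure RMDP (Q A AP : Type*) where
  /-- the sets of transition probability distributions -/
  Γ : Q → A → Set (PMF Q)
  /-- the labelling function -/
  L : Q → Set AP

/-- The distribution of the state at time `k + 1`, given the states up to time `k`, when the
actions are chosen by `σ` and the next-state distributions by `ξ`. -/
def stepKernel {Q A : Type*} [Finite Q] [MeasurableSpace Q] [DiscreteMeasurableSpace Q]
    (σ : Strategy Q A) (ξ : FinPath Q A → A → PMF Q) (k : ℕ) :
    Kernel (Finset.Iic k → Q) Q where
  toFun h :=
    let ω := FinPath.play σ
      (fun i => h ⟨min i k, Finset.mem_Iic.2 (min_le_right i k)⟩) k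
    (ξ ω (σ ω)).toMeasure
  measurable' := Measurable.of_discrete

instance {Q A : Type*} [Finite Q] [MeasurableSpace Q] [DiscreteMeasurableSpace Q]
    (σ : Strategy Q A) (ξ : FinPath Q A → A → PMF Q) (k : ℕ) :
    IsMarkovKernel (stepKernel σ ξ k) :=
  ⟨fun _ => PMF.toMeasure.isProbabilityMeasure _⟩

/-- The probability measure `Pr_ξ^{q,σ}` on infinite state sequences started at `q`. -/
def pathLaw {Q A : Type*} [Finite Q] [MeasurableSpace Q] [DiscreteMeasurableSpace Q]
    (σ : Strategy Q A) (ξ : FinPath Q A → A → PMF Q) (q : Q) : Measure (ℕ → Q) :=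
  Kernel.trajMeasure (X := fun _ => Q) (Measure.dirac q) (stepKernel σ ξ)

namespace RMDP

variable {Q A AP : Type*}

/-- Adversaries: functions choosing, for every finite path `ω` and action `a`, an element of
`Γ (last ω) a`. -/
def Adversary (M : RMDP Q A AP) : Type _ :=
  {ξ : FinPath Q A → A → PMF Q // ∀ ω a, ξ ω a ∈ M.Γ ω.last a}

variable [Finite Q] [MeasurableSpace Q] [DiscreteMeasurableSpace Q]

/-- The probability that `M` satisfies `φ` from `q` under the strategy `σ` and adversary `ξ`. -/
def satProb (M : RMDP Q A AP) (φ : LTLf AP) (σ : Strategy Q A) (ξ : M.Adversary) (q : Q) : ℝ≥0∞ :=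
  pathLaw σ ξ.1 q {π | φ.SatBy M.L π}

/-- The worst-case satisfaction probability under `σ`. -/
def lowerProb (M : RMDP Q A AP) (φ : LTLf AP) (σ : Strategy Q A) (q : Q) : ℝ≥0∞ :=
  ⨅ ξ : M.Adversary, M.satProb φ σ ξ q

/-- The best-case satisfaction probability under `σ`. -/
def upperProb (M : RMDP Q A AP) (φ : LTLf AP) (σ : Strategy Q A) (q : Q) : ℝ≥0∞ :=
  ⨆ ξ : M.Adversary, M.satProb φ σ ξ q

/-- `σ` is an optimal robust strategy for `φ`: from every state it maximizes the worst-case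
satisfaction probability among all strategies. -/
def IsOptimalRobust (M : RMDP Q A AP) (φ : LTLf AP) (σ : Strategy Q A) : Prop :=
  ∀ (q : Q) (σ' : Strategy Q A), M.lowerProb φ σ' q ≤ M.lowerProb φ σ q

end RMDP

/-! ### The switched stochastic process -/

/-- The switched system `x_{k+1} = f_{a_k}(x_k, w_k)` with state in `ℝⁿ` and noise in a bounded set
`W ⊆ ℝᵈ`. -/
structure SwitchedSystem (n d : ℕ) (A : Type*) where
  /-- the set of noise values -/
  W : Set (EuclideanSpace ℝ (Fin d))
  bounded_W : Bornology.IsBounded W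
  /-- the vector fields -/
  f : A → EuclideanSpace ℝ (Fin n) → W → EuclideanSpace ℝ (Fin n)
  measurable_f : ∀ a, Measurable fun p : EuclideanSpace ℝ (Fin n) × W => f a p.1 p.2
  /-- the Lipschitz constants with respect to the noise -/
  Lw : EuclideanSpace ℝ (Fin n) → A → ℝ≥0
  lipschitz_f : ∀ a x, LipschitzWith (Lw x a) (f a x)

namespace SwitchedSystem

variable {n d : ℕ} {A AP : Type*}

/-- The transition kernel `T^a(B ∣ x) = ∫_W 1_B(f_a(x,v)) P_w(dv)`. -/
def T (S : SwitchedSystem n d A) (Pw : Measure S.W) (a : A) (x : EuclideanSpace ℝ (Fin n))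
    (B : Set (EuclideanSpace ℝ (Fin n))) : ℝ≥0∞ :=
  Pw {v | S.f a x v ∈ B}

/-- The trajectory up to time `k` from `x₀`, under the strategy `σ`, for the noise sequence `w`. -/
def trajectory (S : SwitchedSystem n d A) (σ : Strategy (EuclideanSpace ℝ (Fin n)) A)
    (x₀ : EuclideanSpace ℝ (Fin n)) (w : ℕ → S.W) : ℕ → FinPath (EuclideanSpace ℝ (Fin n)) A
  | 0 => .init x₀
  | k + 1 =>
      let ω := S.trajectory σ x₀ w k
      .step ω (σ ω) (S.f (σ ω) ω.last (w k))

/-- The probability that the process with i.i.d. noise of law `Pw`, started at `x₀` and controlled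
by `σ`, satisfies `φ`. -/
def satProb (S : SwitchedSystem n d A) (Pw : Measure S.W)
    (L : EuclideanSpace ℝ (Fin n) → Set AP) (φ : LTLf AP)
    (σ : Strategy (EuclideanSpace ℝ (Fin n)) A) (x₀ : EuclideanSpace ℝ (Fin n)) : ℝ≥0∞ :=
  Measure.infinitePi (fun _ : ℕ => Pw)
    {w | φ.SatBy L fun k => (S.trajectory σ x₀ w k).last}

end SwitchedSystem

/-! ### Regions of interest, partition and abstraction -/

/-- A bounded set `X ⊆ ℝⁿ`, regions of interest `r_i ⊆ X` and a finite partition of `ℝⁿ` into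
safe cells (which partition `X` and respect the regions) and the unsafe cell `ℝⁿ \ X`. -/
structure Partition (n : ℕ) (ι Q : Type*) where
  X : Set (EuclideanSpace ℝ (Fin n))
  bounded_X : Bornology.IsBounded X
  /-- the regions of interest other than `ℝⁿ \ X` -/
  region : ι → Set (EuclideanSpace ℝ (Fin n))
  region_subset : ∀ i, region i ⊆ X
  /-- the region in `ℝⁿ` associated with an abstract state -/
  cell : Q → Set (EuclideanSpace ℝ (Fin n))
  /-- the unsafe state -/
  qu : Q
  cell_qu : cell qu = Xᶜ
  cell_nonempty : ∀ q, q ≠ qu → (cell q).Nonempty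
  cell_disjoint : ∀ q q', q ≠ qu → q' ≠ qu → q ≠ q' → cell q ∩ cell q' = ∅
  iUnion_cell : (⋃ q, ⋃ _ : q ≠ qu, cell q) = X
  cell_respects : ∀ q i, q ≠ qu → cell q ∩ region i = ∅ ∨ cell q ∩ region i = cell q
  measurableSet_cell : ∀ q, MeasurableSet (cell q)

namespace Partition

variable {n d : ℕ} {A ι Q : Type*}

/-- The labelling function of the process. The atomic propositions are `some i`, true on the
region `r_i`, and `none`, the proposition `p_u`, true on `ℝⁿ \ X`. -/
def label (P : Partition n ι Q) (x : EuclideanSpace ℝ (Fin n)) : Set (Option ι) :=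
  {p | match p with
    | some i => x ∈ P.region i
    | none => x ∉ P.X}

theorem exists_mem_cell (P : Partition n ι Q) (x : EuclideanSpace ℝ (Fin n)) :
    ∃ q, x ∈ P.cell q := by
  by_cases hx : x ∈ P.X
  · rw [← P.iUnion_cell] at hx
    simp only [Set.mem_iUnion] at hx
    obtain ⟨q, _, h⟩ := hx
    exact ⟨q, h⟩
  · exact ⟨P.qu, by rw [P.cell_qu]; exact hx⟩

/-- The map sending a continuous state to the cell that contains it. -/
def J (P : Partition n ι Q) (x : EuclideanSpace ℝ (Fin n)) : Q :=
  (P.exists_mem_cell x).choose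

theorem J_eq_iff (P : Partition n ι Q) (x : EuclideanSpace ℝ (Fin n)) (q : Q) :
    P.J x = q ↔ x ∈ P.cell q := by
  have hJ : x ∈ P.cell (P.J x) := (P.exists_mem_cell x).choose_spec
  have hX : ∀ q, q ≠ P.qu → x ∈ P.cell q → x ∈ P.X := by
    intro q hq hx
    rw [← P.iUnion_cell]
    simp only [Set.mem_iUnion]
    exact ⟨q, hq, hx⟩
  have hu : x ∈ P.cell P.qu → x ∉ P.X := by
    intro h
    rwa [P.cell_qu] at h
  constructor
  · rintro rfl
    exact hJ
  · intro hx
    by_contra hne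
    by_cases h1 : P.J x = P.qu
    · rw [h1] at hJ hne
      exact hu hJ (hX q (Ne.symm hne) hx)
    · by_cases h2 : q = P.qu
      · rw [h2] at hx
        exact hu hx (hX _ h1 hJ)
      · have := P.cell_disjoint _ _ h1 h2 hne
        exact (Set.ext_iff.1 this x).1 ⟨hJ, hx⟩

/-- The refinement `σ_x(ω_x) = σ(J(ω_x))` of a strategy of the abstraction to the process. -/
def refine (P : Partition n ι Q) (σ : Strategy Q A) : Strategy (EuclideanSpace ℝ (Fin n)) A :=
  fun ω => σ (ω.map P.J)

/-- `M` is an RMDP over the cells of the partition: cells carry the labels of their points, and the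
unsafe state is absorbing. -/
structure IsAbstraction (P : Partition n ι Q) (M : RMDP Q A (Option ι)) : Prop where
  label_eq : ∀ q, ∀ x ∈ P.cell q, M.L q = P.label x
  absorbing : ∀ a, M.Γ P.qu a = {PMF.pure P.qu}

/-- `M` is a sound abstraction of the process with noise law `Pw`: for all `x` in a safe cell `q`
and all actions `a`, the distribution `γ_{x,a}(q') = T^a(q' ∣ x)` belongs to `Γ_{q,a}`. -/
def IsSound (P : Partition n ι Q) (S : SwitchedSystem n d A) (Pw : Measure S.W)
    (M : RMDP Q A (Option ι)) : Prop :=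
  ∀ q, q ≠ P.qu → ∀ x ∈ P.cell q, ∀ a,
    ∃ γ ∈ M.Γ q a, ∀ q', γ q' = S.T Pw a x (P.cell q')

/-- Leaving the safe cells cannot help to satisfy `φ` in `M`: a path of states in which the unsafe
state is absorbing satisfies `φ` only if it also satisfies `φ ∧ G ¬p_u`. -/
def ExitViolates (P : Partition n ι Q) (M : RMDP Q A (Option ι)) (φ : LTLf (Option ι)) : Prop :=
  ∀ π : ℕ → Q, (∀ k, π k = P.qu → π (k + 1) = P.qu) →
    φ.SatBy M.L π → φ.andSafe.SatBy M.L π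

end Partition

/-! ### Data and confidence -/

/-- `w₁, …, w_N` are i.i.d. random variables with law `Pw`. -/
structure IsIIDSample {Ω 𝒲 : Type*} [MeasurableSpace Ω] [MeasurableSpace 𝒲] (μ : Measure Ω)
    (Pw : Measure 𝒲) {N : ℕ} (w : Fin N → Ω → 𝒲) : Prop where
  measurable : ∀ i, Measurable (w i)
  map_eq : ∀ i, μ.map (w i) = Pw
  indep : iIndepFun w μ

/-- `E` holds with confidence `c`: it holds on an event of probability at least `c`. -/
def WithConfidence {Ω : Type*} [MeasurableSpace Ω] (μ : Measure Ω) (c : ℝ) (E : Ω → Prop) : Prop :=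
  ∃ B, MeasurableSet B ∧ (∀ ω ∈ B, E ω) ∧ ENNReal.ofReal c ≤ μ B

end DataDrivenSynthesis

end

open DataDrivenSynthesis

/-! Fix a sample at which the RMDP is sound; confidence then only transports this event. The law of
the next cell given a cell history is a mixture of the laws $T^a(\cdot\mid x)$ over states $x$ of
the current cell. It need not belong to $\Gamma_{q,a}$, since no convexity is assumed, so an
adversary cannot simply copy the process. Instead it carries one representative state along each
history and plays the transition law of that state, which soundness puts in $\Gamma$
(`exists_adversary_of_selection`).

Representatives come from averaging: a function on an event of positive probability takes a value at
most its mean and a value at least its mean. Let $H$ be the probability that the process, from a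
given history and state, eventually satisfies the formula. $H$ is superharmonic, so choosing
representatives with $H$ at most its mean gives one adversary whose value is at most $H$ at every
horizon (`exists_adversary_iterate_le`); this is the lower bound. For the upper bound, the opposite
choice with a finite-horizon value gives an adversary for each horizon
(`exists_adversary_le_iterate`), which suffices because both the satisfaction probability and
$\overline p$ are suprema.

Both probabilities become limits of iterated one-step operators, since satisfaction means reaching a
set of finite paths closed under extension. Soundness says nothing about $q_u$, so the process is
frozen there: this leaves satisfaction of $\varphi\wedge\mathcal G\neg\mathfrak p_u$ unchanged and
makes the abstraction sound everywhere. The second claim reduces to the first because $q_u$ is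
almost surely absorbing under every adversary. -/

namespace DataDrivenSynthesis

/-! ### Finite paths -/

namespace FinPath

variable {S A : Type*}

/-- The number of transitions of a finite path. -/
def length : FinPath S A → ℕ
  | init _ => 0
  | step ω _ _ => ω.length + 1

/-- The `i`-th state of a finite path, and the last one if there are fewer states. -/
def state : FinPath S A → ℕ → S
  | init s, _ => s
  | step ω _ s, i => if i ≤ ω.length then ω.state i else s

theorem state_step_of_le (ω : FinPath S A) (a : A) (s : S) {i : ℕ} (hi : i ≤ ω.length) :
    (ω.step a s).state i = ω.state i := by
  simp [state, hi]

@[simp]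
theorem length_play (σ : FinPath S A → A) (s : ℕ → S) (k : ℕ) : (play σ s k).length = k := by
  induction k with
  | zero => rfl
  | succ k ih => simp [play, length, ih]

theorem state_play (σ : FinPath S A → A) (s : ℕ → S) {k i : ℕ} (hi : i ≤ k) :
    (play σ s k).state i = s i := by
  induction k with
  | zero =>
    obtain rfl : i = 0 := by lia
    rfl
  | succ k ih =>
    rcases hi.lt_or_eq with h | rfl
    · rw [play, state_step_of_le _ _ _ (by simpa using Nat.lt_succ_iff.1 h), ih (by lia)]
    · simp [play, state]

@[simp]
theorem last_play (σ : FinPath S A → A) (s : ℕ → S) (k : ℕ) : (play σ s k).last = s k := by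
  cases k <;> rfl

theorem play_congr (σ : FinPath S A → A) {s s' : ℕ → S} {k : ℕ} (h : ∀ i ≤ k, s i = s' i) :
    play σ s k = play σ s' k := by
  induction k with
  | zero => simp [play, h]
  | succ k ih => rw [play, play, ih fun i hi => h i (by lia), h (k + 1) le_rfl]

/-- The transitions of a finite path as a list, which determines the path. -/
def toList : FinPath S A → List (Option A × S)
  | init s => [(none, s)]
  | step ω a s => (some a, s) :: ω.toList

theorem toList_injective : Function.Injective (toList : FinPath S A → List (Option A × S)) := by
  intro ω
  induction ω with
  | init s => intro ω' h; cases ω' <;> simp_all [toList]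
  | step ω a s ih =>
    intro ω' h
    cases ω' with
    | init => simp [toList] at h
    | step ω' a' s' =>
      simp only [toList, List.cons.injEq, Prod.mk.injEq, Option.some.injEq] at h
      obtain ⟨⟨rfl, rfl⟩, h⟩ := h
      rw [ih h]

instance [Countable S] [Countable A] : Countable (FinPath S A) :=
  toList_injective.countable

-- With countably many histories, joint measurability in a history and a state can be checked one
-- history at a time.
instance : MeasurableSpace (FinPath S A) := ⊤

instance : DiscreteMeasurableSpace (FinPath S A) := ⟨fun _ => trivial⟩

end FinPath

/-! ### Satisfaction as reachability in the tree of finite paths -/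

namespace LTLf

variable {AP S A : Type*}

theorem holds_congr (φ : LTLf AP) {ρ ρ' : ℕ → Set AP} {K i : ℕ} (hi : i ≤ K)
    (h : ∀ j ≤ K, ρ j = ρ' j) : φ.Holds ρ K i ↔ φ.Holds ρ' K i := by
  induction φ generalizing i with
  | top => simp [Holds]
  | atom p => simp [Holds, h i hi]
  | neg φ ih => simp only [Holds, ih hi]
  | and φ ψ ih₁ ih₂ => simp only [Holds, ih₁ hi, ih₂ hi]
  | next φ ih =>
    simp only [Holds]
    exact and_congr_right fun hlt => ih hlt
  | untl φ ψ ih₁ ih₂ =>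
    simp only [Holds]
    refine exists_congr fun j => and_congr_right fun _ => and_congr_right fun hj => ?_
    refine and_congr (ih₂ hj) (forall_congr' fun k => forall_congr' fun _ =>
      forall_congr' fun hk => ih₁ (by lia))

theorem holds_andSafe_iff {ι : Type*} (φ : LTLf (Option ι)) (ρ : ℕ → Set (Option ι)) (K : ℕ) :
    φ.andSafe.Holds ρ K 0 ↔ φ.Holds ρ K 0 ∧ ∀ j ≤ K, none ∉ ρ j := by
  simp [andSafe, globally, eventually, Holds]

/-- The finite paths that have a nonempty prefix whose trace satisfies `φ`. -/
def satPaths (L : S → Set AP) (φ : LTLf AP) : Set (FinPath S A) :=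
  {ω | ∃ K ≤ ω.length, φ.Holds (fun i => L (ω.state i)) K 0}

/-- The witnessing prefix survives every extension, so satisfaction is reachability of a set that is
never left. -/
theorem step_mem_satPaths {L : S → Set AP} {φ : LTLf AP} {ω : FinPath S A}
    (h : ω ∈ φ.satPaths L) (a : A) (s : S) : ω.step a s ∈ φ.satPaths L := by
  obtain ⟨K, hK, h⟩ := h
  refine ⟨K, hK.trans (Nat.le_succ _), ?_⟩
  refine (φ.holds_congr (Nat.zero_le _) fun j hj => ?_).1 h
  rw [FinPath.state_step_of_le _ _ _ (hj.trans hK)]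

theorem play_mem_satPaths {L : S → Set AP} {φ : LTLf AP} {σ : Strategy S A} {s : ℕ → S} {k : ℕ} :
    FinPath.play σ s k ∈ φ.satPaths L ↔ ∃ K ≤ k, φ.Holds (fun i => L (s i)) K 0 := by
  simp only [satPaths, Set.mem_ofPred_eq, FinPath.length_play]
  refine exists_congr fun K => and_congr_right fun hK => ?_
  exact φ.holds_congr (Nat.zero_le _) fun j hj => by rw [FinPath.state_play σ s (hj.trans hK)]

theorem satBy_iff_exists_play (L : S → Set AP) (φ : LTLf AP) (σ : Strategy S A) (s : ℕ → S) :
    φ.SatBy L s ↔ ∃ k, FinPath.play σ s k ∈ φ.satPaths L := by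
  simp only [play_mem_satPaths, SatBy]
  exact ⟨fun ⟨K, h⟩ => ⟨K, K, le_rfl, h⟩, fun ⟨_, K, _, h⟩ => ⟨K, h⟩⟩

theorem monotone_play_mem_satPaths (L : S → Set AP) (φ : LTLf AP) (σ : Strategy S A) (s : ℕ → S) :
    Monotone fun k => FinPath.play σ s k ∈ φ.satPaths L := by
  intro k l hkl
  simp only [play_mem_satPaths]
  exact fun ⟨K, hK, h⟩ => ⟨K, hK.trans hkl, h⟩

end LTLf

end DataDrivenSynthesis

namespace DataDrivenSynthesis

/-! ### Path laws of the abstraction -/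

section PathLaw

variable {Q A : Type*}

/-- The one-step expectation operator on functions of the history. -/
noncomputable def historyStep (σ : Strategy Q A) (ξ : FinPath Q A → A → PMF Q)
    (F : FinPath Q A → ℝ≥0∞) (ω : FinPath Q A) : ℝ≥0∞ :=
  ∑' q, ξ ω (σ ω) q * F (ω.step (σ ω) q)

variable [Finite Q] [MeasurableSpace Q] [DiscreteMeasurableSpace Q]

theorem lintegral_toMeasure (p : PMF Q) (F : Q → ℝ≥0∞) :
    ∫⁻ q, F q ∂p.toMeasure = ∑' q, p q * F q := by
  have := Fintype.ofFinite Q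
  rw [lintegral_fintype, tsum_fintype]
  exact Finset.sum_congr rfl fun q _ => by
    rw [PMF.toMeasure_apply_singleton _ _ (measurableSet_singleton q), mul_comm]

theorem measurable_play (σ : Strategy Q A) (k : ℕ) :
    Measurable fun s : ℕ → Q => FinPath.play σ s k := by
  let g : (Fin (k + 1) → Q) → FinPath Q A := fun h =>
    FinPath.play σ (fun i => h ⟨min i k, by lia⟩) k
  have : (fun s : ℕ → Q => FinPath.play σ s k) = g ∘ fun s i => s i := by
    ext s
    exact FinPath.play_congr σ fun i hi => by simp [hi]
  rw [this]
  exact (Measurable.of_discrete (f := g)).comp (by fun_prop)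

/-- The joint law of the states up to time `k` and the state at `k + 1` is the composition product
with `stepKernel`; disintegrate it. -/
theorem lintegral_play_succ (σ : Strategy Q A) (ξ : FinPath Q A → A → PMF Q) (q : Q)
    (F : FinPath Q A → ℝ≥0∞) (k : ℕ) :
    ∫⁻ s, F (FinPath.play σ s (k + 1)) ∂pathLaw σ ξ q =
      ∫⁻ s, historyStep σ ξ F (FinPath.play σ s k) ∂pathLaw σ ξ q := by
  let p : (Finset.Iic k → Q) → FinPath Q A := fun h =>
    FinPath.play σ (fun i => h ⟨min i k, Finset.mem_Iic.2 (min_le_right i k)⟩) k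
  let G : (Finset.Iic k → Q) × Q → ℝ≥0∞ := fun y => F ((p y.1).step (σ (p y.1)) y.2)
  have hp (s : ℕ → Q) : p (Preorder.frestrictLe k s) = FinPath.play σ s k :=
    FinPath.play_congr σ fun i hi => by simp [hi]
  have hG : Measurable G := Measurable.of_discrete
  calc
    _ = ∫⁻ s, G (Preorder.frestrictLe k s, s (k + 1)) ∂pathLaw σ ξ q := by
      simp only [G, hp, FinPath.play]
    _ = ∫⁻ y, G y ∂((pathLaw σ ξ q).map fun s => (Preorder.frestrictLe k s, s (k + 1))) := by
      rw [lintegral_map hG (by fun_prop)]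
    _ = ∫⁻ y, G y ∂((pathLaw σ ξ q).map (Preorder.frestrictLe k) ⊗ₘ stepKernel σ ξ k) := by
      rw [pathLaw, Kernel.map_frestrictLe_trajMeasure_compProd_eq_map_trajMeasure]
    _ = ∫⁻ h, ∫⁻ q', G (h, q') ∂stepKernel σ ξ k h ∂(pathLaw σ ξ q).map (Preorder.frestrictLe k) := by
      rw [Measure.lintegral_compProd hG]
    _ = ∫⁻ s, ∫⁻ q', G (Preorder.frestrictLe k s, q') ∂stepKernel σ ξ k (Preorder.frestrictLe k s)
          ∂pathLaw σ ξ q := by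
      rw [lintegral_map .of_discrete (by fun_prop)]
    _ = _ := by
      refine lintegral_congr fun s => ?_
      rw [← hp, historyStep]
      exact lintegral_toMeasure _ _

theorem lintegral_play_zero (σ : Strategy Q A) (ξ : FinPath Q A → A → PMF Q) (q : Q)
    (F : FinPath Q A → ℝ≥0∞) :
    ∫⁻ s, F (FinPath.play σ s 0) ∂pathLaw σ ξ q = F (.init q) := by
  let G : (Finset.Iic 0 → Q) → ℝ≥0∞ := fun h => F (.init (h ⟨0, by simp⟩))
  have hG : Measurable G := Measurable.of_discrete
  calc
    _ = ∫⁻ s, G (Preorder.frestrictLe 0 s) ∂pathLaw σ ξ q := rfl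
    _ = ∫⁻ h, G h ∂(pathLaw σ ξ q).map (Preorder.frestrictLe 0) := by
      rw [lintegral_map hG (by fun_prop)]
    _ = _ := by
      -- A Dirac initial law turns the trajectory measure into the trajectory kernel evaluated at
      -- the one-point history `q`.
      have h : pathLaw σ ξ q =
          Kernel.traj (X := fun _ => Q) (stepKernel σ ξ) 0 (fun _ => q) := by
        have h₀ : (Measure.dirac q).map (MeasurableEquiv.piUnique fun _ : Finset.Iic 0 => Q).symm =
            Measure.dirac fun _ => q := Measure.map_dirac q
        refine Eq.trans ?_ (Measure.dirac_bind
          (Kernel.traj (X := fun _ => Q) (stepKernel σ ξ) 0).measurable fun _ => q)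
        rw [← h₀]
        rfl
      rw [h, Kernel.traj_map_frestrictLe_apply, Kernel.partialTraj_self, Kernel.id_apply,
        lintegral_dirac' _ hG]

/-- The law of the finite paths is obtained by iterating the one-step expectation operator. -/
theorem lintegral_play (σ : Strategy Q A) (ξ : FinPath Q A → A → PMF Q) (q : Q)
    (F : FinPath Q A → ℝ≥0∞) (k : ℕ) :
    ∫⁻ s, F (FinPath.play σ s k) ∂pathLaw σ ξ q = (historyStep σ ξ)^[k] F (.init q) := by
  induction k generalizing F with
  | zero => exact lintegral_play_zero σ ξ q F
  | succ k ih => rw [lintegral_play_succ, ih, Function.iterate_succ_apply]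

theorem pathLaw_satBy {AP : Type*} (L : Q → Set AP) (φ : LTLf AP) (σ : Strategy Q A)
    (ξ : FinPath Q A → A → PMF Q) (q : Q) :
    pathLaw σ ξ q {s | φ.SatBy L s} =
      ⨆ k, (historyStep σ ξ)^[k] ((φ.satPaths L).indicator 1) (.init q) := by
  have h : {s | φ.SatBy L s} = ⋃ k, {s | FinPath.play σ s k ∈ φ.satPaths L} := by
    ext s
    simp [φ.satBy_iff_exists_play L σ s]
  have hmono : Monotone fun k => {s | FinPath.play σ s k ∈ φ.satPaths L} :=
    fun k l hkl s => φ.monotone_play_mem_satPaths L σ s hkl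
  rw [h, hmono.measure_iUnion]
  refine iSup_congr fun k => ?_
  rw [← lintegral_play]
  exact (lintegral_indicator_one (measurable_play σ k .of_discrete)).symm

end PathLaw

/-! ### Systems driven by independent noise -/

section Noise

variable {Z W : Type*}

/-- The states visited from `z` under the noise sequence `w`. -/
def noiseOrbit (F : Z → W → Z) (z : Z) (w : ℕ → W) : ℕ → Z
  | 0 => z
  | k + 1 => F (noiseOrbit F z w k) (w k)

/-- Agreement is required only at the points visited by the first orbit, which permits changing the
dynamics off safe paths. -/
theorem noiseOrbit_congr {F F' : Z → W → Z} {z : Z} {w : ℕ → W} {k : ℕ}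
    (h : ∀ i < k, F (noiseOrbit F z w i) = F' (noiseOrbit F z w i)) :
    noiseOrbit F z w k = noiseOrbit F' z w k := by
  induction k with
  | zero => rfl
  | succ k ih =>
    rw [noiseOrbit, noiseOrbit, h k (by lia), ih fun i hi => h i (by lia)]

variable [MeasurableSpace W]

/-- The one-step expectation operator. -/
noncomputable def noiseStep (Pw : Measure W) (F : Z → W → Z) (H : Z → ℝ≥0∞) (z : Z) : ℝ≥0∞ :=
  ∫⁻ v, H (F z v) ∂Pw

theorem noiseStep_mono (Pw : Measure W) (F : Z → W → Z) : Monotone (noiseStep Pw F) :=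
  fun _ _ h _ => lintegral_mono fun _ => h _

variable {F : Z → W → Z} {Pw : Measure W} [IsProbabilityMeasure Pw]

theorem monotone_iterate_noiseStep_indicator {U : Set Z} (hinv : ∀ z ∈ U, ∀ v, F z v ∈ U) :
    Monotone fun k => (noiseStep Pw F)^[k] (U.indicator 1) := by
  refine (noiseStep_mono Pw F).monotone_iterate_of_le_map fun z => ?_
  by_cases hz : z ∈ U
  · simp [noiseStep, hz, hinv z hz]
  · simp [hz]

variable [MeasurableSpace Z]

theorem measurable_noiseStep (hF : Measurable (Function.uncurry F)) {H : Z → ℝ≥0∞}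
    (hH : Measurable H) : Measurable (noiseStep Pw F H) :=
  (hH.comp hF).lintegral_prod_right'

theorem measurable_iterate_noiseStep (hF : Measurable (Function.uncurry F)) {H : Z → ℝ≥0∞}
    (hH : Measurable H) (k : ℕ) : Measurable ((noiseStep Pw F)^[k] H) := by
  induction k with
  | zero => exact hH
  | succ k ih =>
    rw [Function.iterate_succ_apply']
    exact measurable_noiseStep hF ih

/-- The state at time `k` depends only on the noise before `k`; hence its measurability and its
independence of `w k`. -/
theorem exists_measurable_noiseOrbit (hF : Measurable (Function.uncurry F)) (z : Z) (k : ℕ) :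
    ∃ g : (Finset.range k → W) → Z, Measurable g ∧
      ∀ w, noiseOrbit F z w k = g fun i => w i := by
  induction k with
  | zero => exact ⟨fun _ => z, measurable_const, fun _ => rfl⟩
  | succ k ih =>
    obtain ⟨g, hg, h⟩ := ih
    refine ⟨fun w => F (g fun i => w ⟨i, by have := Finset.mem_range.1 i.2; simp; lia⟩)
      (w ⟨k, by simp⟩), ?_, fun w => by rw [noiseOrbit, h]⟩
    exact hF.comp ((hg.comp (by fun_prop)).prodMk (by fun_prop))

theorem measurable_noiseOrbit (hF : Measurable (Function.uncurry F)) (z : Z) (k : ℕ) :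
    Measurable fun w => noiseOrbit F z w k := by
  obtain ⟨g, hg, h⟩ := exists_measurable_noiseOrbit hF z k
  simp only [h]
  exact hg.comp (by fun_prop)

theorem lintegral_noiseOrbit_succ (hF : Measurable (Function.uncurry F)) (z : Z) {H : Z → ℝ≥0∞}
    (hH : Measurable H) (k : ℕ) :
    ∫⁻ w, H (noiseOrbit F z w (k + 1)) ∂Measure.infinitePi (fun _ : ℕ => Pw) =
      ∫⁻ w, noiseStep Pw F H (noiseOrbit F z w k) ∂Measure.infinitePi (fun _ : ℕ => Pw) := by
  set ν := Measure.infinitePi (fun _ : ℕ => Pw)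
  have hm := measurable_noiseOrbit hF z k
  have hind : IndepFun (fun w : ℕ → W => noiseOrbit F z w k) (fun w => w k) ν := by
    obtain ⟨g, hg, h⟩ := exists_measurable_noiseOrbit hF z k
    have h₁ : iIndepFun (fun (i : ℕ) (w : ℕ → W) => w i) ν :=
      iIndepFun_infinitePi (X := fun _ v => v) fun _ => measurable_id
    have h₂ := h₁.indepFun_finset (Finset.range k) {k} (by simp) (by fun_prop)
    have h₃ := h₂.comp hg (measurable_pi_apply (⟨k, by simp⟩ : ({k} : Finset ℕ)))
    simp only [h]
    exact h₃
  have hprod : ν.map (fun w => (noiseOrbit F z w k, w k)) =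
      (ν.map fun w => noiseOrbit F z w k).prod Pw := by
    rw [hind.map_prod_eq_prod_map_map hm.aemeasurable
      (measurable_pi_apply k).aemeasurable, Measure.infinitePi_map_eval]
  calc
    _ = ∫⁻ y, H (F y.1 y.2) ∂ν.map (fun w => (noiseOrbit F z w k, w k)) := by
      exact (lintegral_map (hH.comp hF) (hm.prodMk (measurable_pi_apply k))).symm
    _ = ∫⁻ y, noiseStep Pw F H y ∂ν.map fun w => noiseOrbit F z w k := by
      rw [hprod]
      exact lintegral_prod _ (hH.comp hF).aemeasurable
    _ = _ := lintegral_map (measurable_noiseStep hF hH) hm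

/-- The law of the orbit is obtained by iterating the one-step expectation operator. -/
theorem lintegral_noiseOrbit (hF : Measurable (Function.uncurry F)) (z : Z) {H : Z → ℝ≥0∞}
    (hH : Measurable H) (k : ℕ) :
    ∫⁻ w, H (noiseOrbit F z w k) ∂Measure.infinitePi (fun _ : ℕ => Pw) =
      (noiseStep Pw F)^[k] H z := by
  induction k generalizing H with
  | zero => simp [noiseOrbit]
  | succ k ih =>
    rw [lintegral_noiseOrbit_succ hF z hH, ih (measurable_noiseStep hF hH),
      Function.iterate_succ_apply]

/-- The probability to reach a set which the system does not leave. -/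
theorem infinitePi_exists_noiseOrbit_mem (hF : Measurable (Function.uncurry F)) (z : Z)
    {U : Set Z} (hU : MeasurableSet U) (hinv : ∀ z ∈ U, ∀ v, F z v ∈ U) :
    Measure.infinitePi (fun _ : ℕ => Pw) {w | ∃ k, noiseOrbit F z w k ∈ U} =
      ⨆ k, (noiseStep Pw F)^[k] (U.indicator 1) z := by
  have h : {w | ∃ k, noiseOrbit F z w k ∈ U} = ⋃ k, {w | noiseOrbit F z w k ∈ U} := by
    ext w
    simp
  have hmono : Monotone fun k => {w | noiseOrbit F z w k ∈ U} :=
    monotone_nat_of_le_succ fun k w hw => hinv (noiseOrbit F z w k) hw (w k)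
  rw [h, hmono.measure_iUnion]
  refine iSup_congr fun k => ?_
  rw [← lintegral_noiseOrbit hF z (measurable_one.indicator hU)]
  exact (lintegral_indicator_one (measurable_noiseOrbit hF z k hU)).symm

end Noise

end DataDrivenSynthesis

namespace DataDrivenSynthesis

/-! ### Adversaries that imitate the concrete process -/

section Coupling

variable {X W Q A AP : Type*}

/-- One step of the process, together with the history of cells and actions. The strategy only
sees the history. -/
def coupledStep (σ : Strategy Q A) (J : X → Q) (f : A → X → W → X) (z : FinPath Q A × X) (v : W) :
    FinPath Q A × X :=
  (z.1.step (σ z.1) (J (f (σ z.1) z.2 v)), f (σ z.1) z.2 v)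

/-- An adversary that tracks a representative concrete state along each history: successive
representatives can be chosen freely subject to a condition `G` that is satisfiable in every cell
reached with positive probability, and the adversary plays the transition probabilities of the
representative. -/
theorem exists_adversary_of_selection [MeasurableSpace W] {Pw : Measure W} {J : X → Q}
    {f : A → X → W → X} {M : RMDP Q A AP}
    (hne : ∀ q a, (M.Γ q a).Nonempty)
    (hsound : ∀ x a, ∃ γ ∈ M.Γ (J x) a, ∀ q, γ q = Pw {v | J (f a x v) = q})
    (G : FinPath Q A → A → X → Q → X → Prop)
    (hG : ∀ ω a x q, Pw {v | J (f a x v) = q} ≠ 0 → ∃ x', J x' = q ∧ G ω a x q x') (x₀ : X) :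
    ∃ (ξ : M.Adversary) (r : FinPath Q A → X), r (.init (J x₀)) = x₀ ∧
      ∀ ω, J (r ω) = ω.last → ∀ a q, ξ.1 ω a q = Pw {v | J (f a (r ω) v) = q} ∧
        (Pw {v | J (f a (r ω) v) = q} ≠ 0 →
          J (r (ω.step a q)) = q ∧ G ω a (r ω) q (r (ω.step a q))) := by
  classical
  choose γ hγ hγ' using hsound
  choose g hg using hG
  let r : FinPath Q A → X := fun ω => FinPath.rec (fun _ => x₀)
    (fun ω a q x => if h : Pw {v | J (f a x v) = q} ≠ 0 then g ω a x q h else x₀) ω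
  have hr (ω : FinPath Q A) (a : A) (q : Q) (h : Pw {v | J (f a (r ω) v) = q} ≠ 0) :
      r (ω.step a q) = g ω a (r ω) q h := dif_pos h
  -- Where the representative lies in the wrong cell, any element of `Γ` keeps the adversary
  -- admissible.
  refine ⟨⟨fun ω a => if J (r ω) = ω.last then γ (r ω) a else (hne ω.last a).some, ?_⟩, r, rfl, ?_⟩
  · intro ω a
    dsimp only
    split_ifs with h
    · rw [← h]
      exact hγ _ _
    · exact (hne _ _).some_mem
  · intro ω hω a q
    refine ⟨by simp only [if_pos hω, hγ'], fun h => ?_⟩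
    rw [hr ω a q h]
    exact hg ω a (r ω) q h

variable [MeasurableSpace X] [MeasurableSpace W] [MeasurableSpace Q]

theorem measurable_coupledStep [Countable Q] [DiscreteMeasurableSpace Q] [Countable A]
    (σ : Strategy Q A) {J : X → Q} (hJ : Measurable J) {f : A → X → W → X}
    (hf : ∀ a, Measurable fun p : X × W => f a p.1 p.2) :
    Measurable (Function.uncurry (coupledStep σ J f)) := by
  have h : Measurable fun p : FinPath Q A × (X × W) => coupledStep σ J f (p.1, p.2.1) p.2.2 :=
    measurable_from_prod_countable_right fun ω =>
      (((Measurable.of_discrete (f := fun q => ω.step (σ ω) q)).comp (hJ.comp (hf (σ ω)))).prodMk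
        (hf (σ ω)))
  exact h.comp MeasurableEquiv.prodAssoc.measurable

/-- Splitting the noise space by the cell reached fixes the next history on each piece, for
comparison with `historyStep` term by term. -/
theorem noiseStep_coupledStep [Countable Q] [DiscreteMeasurableSpace Q] (Pw : Measure W)
    (σ : Strategy Q A) {J : X → Q} (hJ : Measurable J) {f : A → X → W → X}
    (hf : ∀ a, Measurable fun p : X × W => f a p.1 p.2) (H : FinPath Q A × X → ℝ≥0∞)
    (ω : FinPath Q A) (x : X) :
    noiseStep Pw (coupledStep σ J f) H (ω, x) =
      ∑' q, ∫⁻ v in {v | J (f (σ ω) x v) = q}, H (ω.step (σ ω) q, f (σ ω) x v) ∂Pw := by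
  have hm (q : Q) : MeasurableSet {v | J (f (σ ω) x v) = q} :=
    (hJ.comp ((hf (σ ω)).comp measurable_prodMk_left)) (measurableSet_singleton q)
  have hU : ⋃ q, {v | J (f (σ ω) x v) = q} = Set.univ := by
    ext v
    simp
  rw [noiseStep, ← setLIntegral_univ, ← hU, lintegral_iUnion hm]
  · refine tsum_congr fun q => setLIntegral_congr_fun (hm q) fun v hv => ?_
    rw [← show J (f (σ ω) x v) = q from hv]
    rfl
  · intro q q' hqq'
    exact Set.disjoint_left.2 fun v hv hv' => hqq' (hv.symm.trans hv')

variable [Countable Q] [DiscreteMeasurableSpace Q] {Pw : Measure W}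
  [IsProbabilityMeasure Pw] {J : X → Q} {f : A → X → W → X} {M : RMDP Q A AP}

/-- Some adversary does not exceed a given superharmonic function of the process. -/
theorem exists_adversary_iterate_le [Countable A] (hJ : Measurable J)
    (hf : ∀ a, Measurable fun p : X × W => f a p.1 p.2)
    (hne : ∀ q a, (M.Γ q a).Nonempty)
    (hsound : ∀ x a, ∃ γ ∈ M.Γ (J x) a, ∀ q, γ q = Pw {v | J (f a x v) = q})
    (σ : Strategy Q A) {H : FinPath Q A × X → ℝ≥0∞} (hH : Measurable H)
    (hsuper : noiseStep Pw (coupledStep σ J f) H ≤ H)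
    {F : FinPath Q A → ℝ≥0∞} (hF : ∀ ω x, F ω ≤ H (ω, x)) (x₀ : X) :
    ∃ ξ : M.Adversary, ∀ k,
      (historyStep σ ξ.1)^[k] F (.init (J x₀)) ≤ H (.init (J x₀), x₀) := by
  obtain ⟨ξ, r, hr₀, hr⟩ := exists_adversary_of_selection hne hsound
    -- The new representative has `H` at most its mean over the noise leading to `q`, written
    -- without division.
    (fun ω a x q x' => Pw {v | J (f a x v) = q} * H (ω.step a q, x') ≤
      ∫⁻ v in {v | J (f a x v) = q}, H (ω.step a q, f a x v) ∂Pw) (fun ω a x q h => by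
    have hm : Measurable fun v => f a x v := (hf a).comp measurable_prodMk_left
    obtain ⟨v, hv, hle⟩ := exists_le_setLAverage (f := fun v => H (ω.step a q, f a x v)) h
      (measure_ne_top _ _) (hH.comp (measurable_const.prodMk hm)).aemeasurable
    refine ⟨f a x v, hv, ?_⟩
    rw [setLAverage_eq, ENNReal.le_div_iff_mul_le (.inl h) (.inl (measure_ne_top _ _))] at hle
    rwa [mul_comm]) x₀
  refine ⟨ξ, fun k => ?_⟩
  suffices h : ∀ ω, J (r ω) = ω.last → (historyStep σ ξ.1)^[k] F ω ≤ H (ω, r ω) by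
    simpa only [hr₀] using h (.init (J x₀)) (by rw [hr₀]; rfl)
  induction k with
  | zero => exact fun ω _ => hF ω (r ω)
  | succ k ih =>
    intro ω hω
    refine le_trans ?_ (hsuper (ω, r ω))
    rw [Function.iterate_succ_apply', historyStep, noiseStep_coupledStep Pw σ hJ hf]
    refine ENNReal.tsum_le_tsum fun q => ?_
    obtain ⟨hξ, hsel⟩ := hr ω hω (σ ω) q
    rw [hξ]
    by_cases h : Pw {v | J (f (σ ω) (r ω) v) = q} = 0
    · simp [h]
    · obtain ⟨hq, hle⟩ := hsel h
      exact le_trans (mul_le_mul_right (ih _ hq) _) hle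

/-- For every horizon, some adversary is at least as good as the process. -/
theorem exists_adversary_le_iterate (hJ : Measurable J)
    (hf : ∀ a, Measurable fun p : X × W => f a p.1 p.2)
    (hne : ∀ q a, (M.Γ q a).Nonempty)
    (hsound : ∀ x a, ∃ γ ∈ M.Γ (J x) a, ∀ q, γ q = Pw {v | J (f a x v) = q})
    (σ : Strategy Q A) {F : FinPath Q A → ℝ≥0∞} (hF : F ≤ 1) (x₀ : X) (m : ℕ) :
    ∃ ξ : M.Adversary,
      (noiseStep Pw (coupledStep σ J f))^[m] (fun z => F z.1) (.init (J x₀), x₀) ≤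
        (historyStep σ ξ.1)^[m] F (.init (J x₀)) := by
  set T := fun k => (noiseStep Pw (coupledStep σ J f))^[k] (fun z => F z.1)
  have hT (k : ℕ) (z) : T k z ≤ 1 := by
    induction k generalizing z with
    | zero => exact hF z.1
    | succ k ih =>
      simp only [T, Function.iterate_succ_apply']
      exact (lintegral_mono fun v => ih _).trans (by simp)
  obtain ⟨ξ, r, hr₀, hr⟩ := exists_adversary_of_selection hne hsound
    -- Now the value is at least the mean; after the step, `m - (ω.length + 1)` transitions remain.
    -- The dependence on `m` makes the adversary depend on the horizon.
    (fun ω a x q x' => ∫⁻ v in {v | J (f a x v) = q},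
      T (m - (ω.length + 1)) (ω.step a q, f a x v) ∂Pw ≤
        Pw {v | J (f a x v) = q} * T (m - (ω.length + 1)) (ω.step a q, x')) (fun ω a x q h => by
    have hm : MeasurableSet {v | J (f a x v) = q} :=
      (hJ.comp ((hf a).comp measurable_prodMk_left)) (measurableSet_singleton q)
    obtain ⟨v, hv, hle⟩ := exists_setLAverage_le
      (f := fun v => T (m - (ω.length + 1)) (ω.step a q, f a x v)) h hm.nullMeasurableSet
      (((lintegral_mono fun v => hT _ _).trans 
        (by simpa using prob_le_one)).trans_lt ENNReal.one_lt_top).ne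
    refine ⟨f a x v, hv, ?_⟩
    rw [setLAverage_eq, ENNReal.div_le_iff_le_mul (.inl h) (.inl (measure_ne_top _ _))] at hle
    rwa [mul_comm]) x₀
  refine ⟨ξ, ?_⟩
  suffices h : ∀ k ω, ω.length + k = m → J (r ω) = ω.last →
      T k (ω, r ω) ≤ (historyStep σ ξ.1)^[k] F ω by
    simpa only [hr₀] using h m (.init (J x₀)) (by simp [FinPath.length]) (by rw [hr₀]; rfl)
  intro k
  induction k with
  | zero => exact fun ω _ _ => le_rfl
  | succ k ih =>
    intro ω hlen hω
    simp only [T, Function.iterate_succ_apply']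
    rw [historyStep, noiseStep_coupledStep Pw σ hJ hf]
    refine ENNReal.tsum_le_tsum fun q => ?_
    obtain ⟨hξ, hsel⟩ := hr ω hω (σ ω) q
    rw [hξ]
    by_cases h : Pw {v | J (f (σ ω) (r ω) v) = q} = 0
    · rw [setLIntegral_measure_zero _ _ h]
      exact zero_le
    · obtain ⟨hq, hle⟩ := hsel h
      rw [show m - (ω.length + 1) = k by lia] at hle
      exact hle.trans (mul_le_mul_right (ih _ (by simp only [FinPath.length]; lia) hq) _)

end Coupling

end DataDrivenSynthesis

namespace DataDrivenSynthesis

/-! ### Stopping the process in the unsafe cell -/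

section Stopping

variable {X W Q A AP : Type*}

theorem fst_noiseOrbit_coupledStep (σ : Strategy Q A) (J : X → Q) (f : A → X → W → X) (x₀ : X)
    (w : ℕ → W) (k : ℕ) :
    (noiseOrbit (coupledStep σ J f) (.init (J x₀), x₀) w k).1 =
      FinPath.play σ
        (fun i => J (noiseOrbit (coupledStep σ J f) (.init (J x₀), x₀) w i).2) k := by
  induction k with
  | zero => rfl
  | succ k ih =>
    rw [FinPath.play, ← ih]
    rfl

/-- A satisfying prefix never visits `qu`, so both dynamics produce the same states along it. -/
theorem satBy_andSafe_of_agree {ι : Type*} {L : Q → Set (Option ι)} {J : X → Q} {qu : Q}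
    (hL : ∀ x, J x = qu → none ∈ L (J x)) {f f' : A → X → W → X}
    (hf : ∀ a x, J x ≠ qu → f a x = f' a x) {φ : LTLf (Option ι)} {σ : Strategy Q A} {z w}
    (h : φ.andSafe.SatBy L fun k => J (noiseOrbit (coupledStep σ J f) z w k).2) :
    φ.andSafe.SatBy L fun k => J (noiseOrbit (coupledStep σ J f') z w k).2 := by
  obtain ⟨K, h⟩ := h
  refine ⟨K, (LTLf.holds_congr _ (Nat.zero_le _) fun k hk => ?_).1 h⟩
  dsimp only
  rw [noiseOrbit_congr (F' := coupledStep σ J f') fun i hi => ?_]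
  funext v
  have hsafe := ((φ.holds_andSafe_iff _ K).1 h).2 i (by lia)
  simp only [coupledStep, hf _ _ fun hq => hsafe (hL _ hq)]

end Stopping

namespace Partition

variable {n d : ℕ} {A ι Q : Type*} (P : Partition n ι Q)

theorem mem_cell_J (x : EuclideanSpace ℝ (Fin n)) : x ∈ P.cell (P.J x) :=
  (P.J_eq_iff x _).1 rfl

theorem measurable_J [Countable Q] [MeasurableSpace Q] : Measurable P.J :=
  measurable_to_countable' fun q => by
    convert P.measurableSet_cell q using 1
    ext x
    exact P.J_eq_iff x q

open Classical in
/-- The vector fields of the process that stops on leaving `X`. -/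
noncomputable def stoppedField (S : SwitchedSystem n d A) (a : A) (x : EuclideanSpace ℝ (Fin n))
    (v : S.W) : EuclideanSpace ℝ (Fin n) :=
  if P.J x = P.qu then x else S.f a x v

theorem measurable_stoppedField [Countable Q] [MeasurableSpace Q] [DiscreteMeasurableSpace Q]
    (S : SwitchedSystem n d A) (a : A) :
    Measurable fun p : EuclideanSpace ℝ (Fin n) × S.W => P.stoppedField S a p.1 p.2 :=
  Measurable.ite ((P.measurable_J.comp measurable_fst) (measurableSet_singleton P.qu))
    measurable_fst (S.measurable_f a)

theorem noiseOrbit_coupledStep_eq_trajectory (S : SwitchedSystem n d A) (σ : Strategy Q A)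
    (x₀ : EuclideanSpace ℝ (Fin n)) (w : ℕ → S.W) (k : ℕ) :
    noiseOrbit (coupledStep σ P.J S.f) (.init (P.J x₀), x₀) w k =
      ((S.trajectory (P.refine σ) x₀ w k).map P.J, (S.trajectory (P.refine σ) x₀ w k).last) := by
  induction k with
  | zero => rfl
  | succ k ih =>
    rw [noiseOrbit, ih]
    rfl

variable {P} {M : RMDP Q A (Option ι)}

theorem IsAbstraction.satBy_trajectory_iff (hM : P.IsAbstraction M) (S : SwitchedSystem n d A)
    (φ : LTLf (Option ι)) (σ : Strategy Q A) (x₀ : EuclideanSpace ℝ (Fin n)) (w : ℕ → S.W) :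
    φ.andSafe.SatBy P.label (fun k => (S.trajectory (P.refine σ) x₀ w k).last) ↔
      ∃ k, (noiseOrbit (coupledStep σ P.J (P.stoppedField S)) (.init (P.J x₀), x₀) w k).1 ∈
        φ.andSafe.satPaths M.L := by
  have hL : ∀ x, P.J x = P.qu → none ∈ M.L (P.J x) := by
    intro x hx
    rw [hM.label_eq _ x (P.mem_cell_J x)]
    have := P.mem_cell_J x
    rwa [hx, P.cell_qu] at this
  have hf : ∀ a x, P.J x ≠ P.qu → P.stoppedField S a x = S.f a x := fun a x hx =>
    funext fun v => if_neg hx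
  have hlabel : P.label = fun x => M.L (P.J x) :=
    funext fun x => (hM.label_eq _ x (P.mem_cell_J x)).symm
  calc
    _ ↔ φ.andSafe.SatBy M.L fun k =>
          P.J (noiseOrbit (coupledStep σ P.J S.f) (.init (P.J x₀), x₀) w k).2 := by
      simp only [LTLf.SatBy, hlabel, noiseOrbit_coupledStep_eq_trajectory]
    _ ↔ φ.andSafe.SatBy M.L fun k =>
          P.J (noiseOrbit (coupledStep σ P.J (P.stoppedField S)) (.init (P.J x₀), x₀) w k).2 :=
      ⟨satBy_andSafe_of_agree hL fun a x hx => (hf a x hx).symm, satBy_andSafe_of_agree hL hf⟩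
    _ ↔ _ := by
      rw [LTLf.satBy_iff_exists_play M.L φ.andSafe σ]
      simp only [← fst_noiseOrbit_coupledStep]

theorem IsAbstraction.nonempty (hM : P.IsAbstraction M) {S : SwitchedSystem n d A}
    {Pw : Measure S.W} (hs : P.IsSound S Pw M) (q : Q) (a : A) : (M.Γ q a).Nonempty := by
  by_cases hq : q = P.qu
  · rw [hq, hM.absorbing]
    exact Set.singleton_nonempty _
  · obtain ⟨x, hx⟩ := P.cell_nonempty q hq
    obtain ⟨γ, hγ, _⟩ := hs q hq x hx a
    exact ⟨γ, hγ⟩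

/-- Freezing in `qu` produces the Dirac law required there by absorption, so soundness extends from
the safe cells to all of $\mathbb R^n$. -/
theorem IsAbstraction.sound_stoppedField (hM : P.IsAbstraction M) {S : SwitchedSystem n d A}
    {Pw : Measure S.W} [IsProbabilityMeasure Pw] (hs : P.IsSound S Pw M)
    (x : EuclideanSpace ℝ (Fin n)) (a : A) :
    ∃ γ ∈ M.Γ (P.J x) a, ∀ q, γ q = Pw {v | P.J (P.stoppedField S a x v) = q} := by
  classical
  by_cases hx : P.J x = P.qu
  · refine ⟨PMF.pure P.qu, by rw [hx, hM.absorbing]; rfl, fun q => ?_⟩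
    by_cases hq : q = P.qu
    · simp [stoppedField, hx, hq]
    · simp [stoppedField, hx, hq, Ne.symm hq]
  · obtain ⟨γ, hγ, h⟩ := hs _ hx x (P.mem_cell_J x) a
    refine ⟨γ, hγ, fun q => ?_⟩
    simp only [h, SwitchedSystem.T, stoppedField, if_neg hx]
    simp only [P.J_eq_iff]

/-! ### Enclosure of the satisfaction probability, and absorption in the unsafe cell -/

section

variable [Finite Q] [MeasurableSpace Q] [DiscreteMeasurableSpace Q]

theorem IsAbstraction.satProb_mem_Icc [Finite A] (hM : P.IsAbstraction M)
    {S : SwitchedSystem n d A} {Pw : Measure S.W} [IsProbabilityMeasure Pw]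
    (hs : P.IsSound S Pw M) (φ : LTLf (Option ι)) (σ : Strategy Q A)
    (x₀ : EuclideanSpace ℝ (Fin n)) :
    S.satProb Pw P.label φ.andSafe (P.refine σ) x₀ ∈
      Set.Icc (M.lowerProb φ.andSafe σ (P.J x₀)) (M.upperProb φ.andSafe σ (P.J x₀)) := by
  set U : Set (FinPath Q A) := φ.andSafe.satPaths M.L
  set V : Set (FinPath Q A × EuclideanSpace ℝ (Fin n)) := Prod.fst ⁻¹' U
  set F := coupledStep σ P.J (P.stoppedField S)
  have hf := P.measurable_stoppedField S
  have hF : Measurable (Function.uncurry F) := measurable_coupledStep σ P.measurable_J hf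
  have hV : MeasurableSet V := measurable_fst .of_discrete
  have hinv : ∀ z ∈ V, ∀ v, F z v ∈ V := fun z hz v => LTLf.step_mem_satPaths hz _ _
  have hmono := monotone_iterate_noiseStep_indicator (Pw := Pw) hinv
  have hmeas (k : ℕ) : Measurable ((noiseStep Pw F)^[k] (V.indicator 1)) :=
    measurable_iterate_noiseStep hF (measurable_one.indicator hV) k
  have hprob : S.satProb Pw P.label φ.andSafe (P.refine σ) x₀ =
      ⨆ k, (noiseStep Pw F)^[k] (V.indicator 1) (.init (P.J x₀), x₀) := by
    rw [← infinitePi_exists_noiseOrbit_mem hF _ hV hinv, SwitchedSystem.satProb]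
    simp only [hM.satBy_trajectory_iff]
    rfl
  have hsat (ξ : M.Adversary) : M.satProb φ.andSafe σ ξ (P.J x₀) =
      ⨆ k, (historyStep σ ξ.1)^[k] (U.indicator 1) (.init (P.J x₀)) :=
    pathLaw_satBy M.L φ.andSafe σ ξ.1 (P.J x₀)
  have hne := hM.nonempty hs
  have hsound := hM.sound_stoppedField hs
  rw [hprob]
  constructor
  -- By monotone convergence, one more step only shifts the horizon in the supremum.
  · have hsuper : noiseStep Pw F (fun z => ⨆ k, (noiseStep Pw F)^[k] (V.indicator 1) z) ≤
        fun z => ⨆ k, (noiseStep Pw F)^[k] (V.indicator 1) z := by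
      intro z
      have hm (k : ℕ) : Measurable fun v => (noiseStep Pw F)^[k] (V.indicator 1) (F z v) :=
        (hmeas k).comp (hF.comp measurable_prodMk_left)
      rw [noiseStep, lintegral_iSup hm fun k l hkl v => hmono hkl _]
      refine iSup_le fun k => le_trans ?_
        (le_iSup (fun k => (noiseStep Pw F)^[k] (V.indicator 1) z) (k + 1))
      rw [Function.iterate_succ_apply', noiseStep]
    obtain ⟨ξ, hξ⟩ := exists_adversary_iterate_le P.measurable_J hf hne hsound σ
      (F := U.indicator 1) (.iSup hmeas) hsuper
      (fun ω x => le_iSup (fun k => (noiseStep Pw F)^[k] (V.indicator 1) (ω, x)) 0) x₀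
    refine (iInf_le _ ξ).trans ?_
    rw [hsat]
    exact iSup_le hξ
  · refine iSup_le fun k => ?_
    obtain ⟨ξ, hξ⟩ := exists_adversary_le_iterate P.measurable_J hf hne hsound σ
      (F := U.indicator 1) (Set.indicator_le_self' fun _ _ => zero_le) x₀ k
    refine hξ.trans (le_trans ?_ (le_iSup _ ξ))
    rw [hsat]
    exact le_iSup (fun k => (historyStep σ ξ.1)^[k] (U.indicator 1) (.init (P.J x₀))) k

/-- Under every adversary, the unsafe cell is almost surely never left. -/
theorem IsAbstraction.ae_absorbing (hM : P.IsAbstraction M) (σ : Strategy Q A) (ξ : M.Adversary)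
    (q : Q) : ∀ᵐ s ∂pathLaw σ ξ.1 q, ∀ k, s k = P.qu → s (k + 1) = P.qu := by
  refine ae_all_iff.2 fun k => ?_
  -- Histories whose last transition leaves `qu`; their one-step probability vanishes since `Γ` at
  -- `qu` contains only the Dirac law.
  let B : Set (FinPath Q A) := {ω | ∃ ω' a q, ω = .step ω' a q ∧ ω'.last = P.qu ∧ q ≠ P.qu}
  have hstep : historyStep σ ξ.1 (B.indicator 1) = 0 := by
    funext ω
    refine ENNReal.tsum_eq_zero.2 fun q => ?_
    by_cases hω : ω.last = P.qu ∧ q ≠ P.qu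
    · have hξ := ξ.2 ω (σ ω)
      rw [hω.1, hM.absorbing, Set.mem_singleton_iff] at hξ
      simp [hξ, hω.2]
    · have : ω.step (σ ω) q ∉ B := by
        rintro ⟨ω', a, q', h, h'⟩
        cases h
        exact hω h'
      simp [this]
  have hzero := lintegral_play_succ σ ξ.1 q (B.indicator 1) k
  rw [hstep] at hzero
  have hmeas : Measurable fun s : ℕ → Q =>
      B.indicator (1 : FinPath Q A → ℝ≥0∞) (FinPath.play σ s (k + 1)) :=
    (Measurable.of_discrete (f := B.indicator (1 : FinPath Q A → ℝ≥0∞))).comp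
      (measurable_play σ (k + 1))
  rw [show (fun s => (0 : FinPath Q A → ℝ≥0∞) (FinPath.play σ s k)) = 0 from rfl,
    lintegral_zero_fun, lintegral_eq_zero_iff hmeas] at hzero
  filter_upwards [hzero] with s hs hk
  by_contra hne
  have : FinPath.play σ s (k + 1) ∈ B := ⟨_, _, _, rfl, by simpa using hk, hne⟩
  simp [this] at hs

theorem IsAbstraction.satProb_eq_andSafe (hM : P.IsAbstraction M) {φ : LTLf (Option ι)}
    (hφ : P.ExitViolates M φ) (σ : Strategy Q A) (ξ : M.Adversary) (q : Q) :
    M.satProb φ σ ξ q = M.satProb φ.andSafe σ ξ q := by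
  refine measure_congr ?_
  filter_upwards [hM.ae_absorbing σ ξ q] with s hs
  exact propext ⟨hφ s hs, fun ⟨K, h⟩ => ⟨K, h.1⟩⟩

end

end Partition

theorem WithConfidence.mono {Ω : Type*} [MeasurableSpace Ω] {μ : Measure Ω} {c : ℝ}
    {E E' : Ω → Prop} (h : WithConfidence μ c E) (hE : ∀ ω, E ω → E' ω) :
    WithConfidence μ c E' := by
  obtain ⟨B, hB, hBE, hc⟩ := h
  exact ⟨B, hB, fun ω hω => hE ω (hBE ω hω), hc⟩

end DataDrivenSynthesis

theorem mainTheorem1 {n d N : ℕ} {A ι Q Ω : Type*} [Finite A] [Finite ι] [Finite Q]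
    [MeasurableSpace Q] [DiscreteMeasurableSpace Q]
    -- the process, the law of its noise, and the partition
    (S : SwitchedSystem n d A) (Pw : Measure S.W) [IsProbabilityMeasure Pw]
    (P : Partition n ι Q)
    -- the i.i.d. samples
    [MeasurableSpace Ω] (μ : Measure Ω) [IsProbabilityMeasure μ]
    (w : Fin N → Ω → S.W) (hw : IsIIDSample μ Pw w)
    -- the abstraction built from the samples, sound with confidence `1 - β`
    (β : ℝ) (hβ : β ∈ Set.Ioo (0 : ℝ) 1)
    (M : (Fin N → S.W) → RMDP Q A (Option ι)) (hM : ∀ D, P.IsAbstraction (M D))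
    (hsound : WithConfidence μ (1 - β) fun ω => P.IsSound S Pw (M fun i => w i ω))
    -- the specification, and a strategy of the abstraction
    (φ : LTLf (Option ι)) (σ : (Fin N → S.W) → Strategy Q A) :
    ((∀ D, (M D).IsOptimalRobust φ.andSafe (σ D)) →
      WithConfidence μ (1 - β) fun ω =>
        let D : Fin N → S.W := fun i => w i ω
        ∀ q, ∀ x₀ ∈ P.cell q,
          S.satProb Pw P.label φ.andSafe (P.refine (σ D)) x₀ ∈
            Set.Icc ((M D).lowerProb φ.andSafe (σ D) q) ((M D).upperProb φ.andSafe (σ D) q)) ∧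
    ((∀ D, P.ExitViolates (M D) φ) → (∀ D, (M D).IsOptimalRobust φ (σ D)) →
      WithConfidence μ (1 - β) fun ω =>
        let D : Fin N → S.W := fun i => w i ω
        ∀ q, ∀ x₀ ∈ P.cell q,
          S.satProb Pw P.label φ.andSafe (P.refine (σ D)) x₀ ∈
            Set.Icc ((M D).lowerProb φ (σ D) q) ((M D).upperProb φ (σ D) q)) := by
  refine ⟨fun _ => hsound.mono fun ω hs q x₀ hx => ?_,
    fun hφ _ => hsound.mono fun ω hs q x₀ hx => ?_⟩
  · obtain rfl := (P.J_eq_iff x₀ q).2 hx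
    exact (hM _).satProb_mem_Icc hs φ _ x₀
  · obtain rfl := (P.J_eq_iff x₀ q).2 hx
    -- The two formulas have equal probability under each adversary, hence equal infima and suprema.
    simp only [RMDP.lowerProb, RMDP.upperProb, (hM _).satProb_eq_andSafe (hφ _)]
    exact (hM _).satProb_mem_Icc hs φ _ x₀
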